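/- Work over $\mathbb C$. A (right) Leibniz algebra is a vector space $L$ with a bilinear bracket such that $[x,[y,z]]=[[x,y],z]-[[x,z],y]$. A derivation of $L$ is a linear map $d\colon L\to L$ with $d([a,b])=[d(a),b]+[a,d(b)]$; $\mathrm{Der}(L)$ is the space of derivations. $ZL^2(L,L)$ is the space of bilinear maps $\varphi\colon L\times L\to L$ with $$[a,\varphi(b,c)]-[\varphi(a,b),c]+[\varphi(a,c),b]+\varphi(a,[b,c])-\varphi([a,b],c)+\varphi([a,c],b)=0\quad\text{for all }a,b,c\in L,$$ $BL^2(L,L)\subseteq ZL^2(L,L)$ is the subspace of the maps $(a,b)\mapsto[d(a),b]+[a,d(b)]-d([a,b])$ with $d\colon L\to L$ linear, and $HL^2(L,L)=ZL^2(L,L)/BL^2(L,L)$. Let $l_2$ and $r_2$ be the two-dimensional Leibniz algebras with basis $e,x$ and non-zero products $[e,x]=e$ for $l_2$, and $[e,x]=e$, $[x,e]=-e$ for $r_2$. For integers $0\le t\le k$ let $\mathcal L_t$ be the direct sum of $t$ copies of $l_2$ and $k-t$ copies of $r_2$, with basis $e_i,x_i$ $(1\le i\le t)$, $f_j,y_j$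 $(1\le j\le k-t)$ and non-zero products $[e_i,x_i]=e_i$, $[f_j,y_j]=-[y_j,f_j]=f_j$. Then: 1. $\dim\mathrm{Der}(\mathcal L_t)=2k-t$ and $\dim BL^2(\mathcal L_t,\mathcal L_t)=4k^2-2k+t$. 2. A bilinear map $\varphi\colon\mathcal L_t\times\mathcal L_t\to\mathcal L_t$ lies in $ZL^2(\mathcal L_t,\mathcal L_t)$ if and only if there are scalars $\alpha_{i,j},\beta^1_{i,j},\dots$ such that the following hold, where (unless restricted further) an index of $e,x$ runs over $1,\dots,t$, an index of $f,y$ runs over $1,\dots,k-t$, and $m$ runs over $1,\dots,t$ in sums of $x_m,e_m$ and over $1,\dots,k-t$ in sums of $y_m,f_m$: $$\begin{aligned} &\varphi(x_i,x_j)=\alpha_{i,j}e_j,\qquad \varphi(x_i,e_j)=0,\qquad \varphi(e_i,e_j)=-\beta^1_{j,i}e_i,\\ &\varphi(e_i,x_i)=\textstyle\sum_m\beta^1_{i,m}x_m+\sum_m\beta^2_{i,m}e_m+\sum_m\beta^3_{i,m}y_m+\sum_m\beta^4_{i,m}f_m,\\ &\varphi(e_j,x_i)=-\beta^2_{j,i}e_i+\nu_{j,i}e_j\quad(i\ne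 j),\\ &\varphi(y_j,x_i)=\gamma^1_{j,i}e_i+\gamma^2_{j,i}f_j,\qquad \varphi(x_i,y_j)=-\gamma^2_{j,i}f_j,\\ &\varphi(f_j,x_i)=-\xi^2_{j,i}e_i+\theta_{j,i}f_j,\qquad \varphi(x_i,f_j)=-\theta_{j,i}f_j,\\ &\varphi(e_i,y_j)=-\beta^4_{i,j}f_j+\tau_{i,j}e_i,\qquad \varphi(y_j,e_i)=\beta^4_{i,j}f_j,\\ &\varphi(e_i,f_j)=-\xi^1_{j,i}e_i+\beta^3_{i,j}f_j,\qquad \varphi(f_j,e_i)=-\beta^3_{i,j}f_j,\\ &\varphi(y_i,y_i)=0,\qquad \varphi(y_j,y_i)=-\varphi(y_i,y_j)=\delta^1_{j,i}f_i+\delta^2_{j,i}f_j\quad(i<j),\\ &\varphi(f_i,y_i)=-\varphi(y_i,f_i)=\textstyle\sum_m\xi^1_{i,m}x_m+\sum_m\xi^2_{i,m}e_m+\sum_m\xi^3_{i,m}y_m+\sum_m\xi^4_{i,m}f_m,\\ &\varphi(f_j,y_i)=-\varphi(y_i,f_j)=-\xi^4_{j,i}f_i+\eta_{j,i}f_j\quad(i\ne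 j),\\ &\varphi(f_i,f_i)=0,\qquad \varphi(f_i,f_j)=-\varphi(f_j,f_i)=-\xi^3_{j,i}f_i+\xi^3_{i,j}f_j\quad(j<i). \end{aligned}$$ 3. $\dim ZL^2(\mathcal L_t,\mathcal L_t)=4k^2-2k+t$, and $HL^2(\mathcal L_t,\mathcal L_t)=0$, i.e. $\dim HL^2(\mathcal L_t,\mathcal L_t)=0$. -/

import Mathlib

/-- A (right) Leibniz algebra structure on a complex vector space `L`: a bilinear bracket
`[x, y] = A.br x y` with `[x, [y, z]] = [[x, y], z] - [[x, z], y]`. -/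
structure LeibnizStr (L : Type*) [AddCommGroup L] [Module ℂ L] where
  br : L →ₗ[ℂ] L →ₗ[ℂ] L
  leibniz : ∀ x y z : L, br x (br y z) = br (br x y) z - br (br x z) y

namespace LeibnizStr

/-- The non-Lie algebra `l₂` on `ℂ²` with basis `e = (1, 0)`, `x = (0, 1)` and the only non-zero
product of basis vectors `[e, x] = e`. -/
def l2 : LeibnizStr (ℂ × ℂ) where
  br := LinearMap.mk₂ ℂ (fun u v => (u.1 * v.2, 0))
    (by intros; ext <;> simp <;> ring) (by intros; ext <;> simp <;> ring)
    (by intros; ext <;> simp <;> ring) (by intros; ext <;> simp <;> ring)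
  leibniz := by intros; ext <;> simp <;> ring

/-- The Lie algebra `r₂` on `ℂ²` with basis `e = (1, 0)`, `x = (0, 1)` and the only non-zero
products of basis vectors `[e, x] = e`, `[x, e] = -e`. -/
def r2 : LeibnizStr (ℂ × ℂ) where
  br := LinearMap.mk₂ ℂ (fun u v => (u.1 * v.2 - u.2 * v.1, 0))
    (by intros; ext <;> simp <;> ring) (by intros; ext <;> simp <;> ring)
    (by intros; ext <;> simp <;> ring) (by intros; ext <;> simp <;> ring)
  leibniz := by intros; ext <;> simp <;> ring

section

variable {L M : Type*} [AddCommGroup L] [Module ℂ L] [AddCommGroup M] [Module ℂ M]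

/-- The direct sum of two Leibniz algebras. -/
def prod (A : LeibnizStr L) (B : LeibnizStr M) : LeibnizStr (L × M) where
  br := LinearMap.mk₂ ℂ (fun u v => (A.br u.1 v.1, B.br u.2 v.2))
    (by intros; ext <;> simp) (by intros; ext <;> simp)
    (by intros; ext <;> simp) (by intros; ext <;> simp)
  leibniz := by
    intro x y z
    ext
    · simpa using A.leibniz x.1 y.1 z.1
    · simpa using B.leibniz x.2 y.2 z.2

/-- The direct sum of `n` copies of a Leibniz algebra. -/
def copies (n : ℕ) (A : LeibnizStr L) : LeibnizStr (Fin n → L) where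
  br := LinearMap.mk₂ ℂ (fun u v i => A.br (u i) (v i))
    (by intros; ext; simp) (by intros; ext; simp)
    (by intros; ext; simp) (by intros; ext; simp)
  leibniz := by
    intro x y z
    funext i
    simpa using A.leibniz (x i) (y i) (z i)

/-- The space `Der(L)` of derivations of `L`. -/
def der (A : LeibnizStr L) : Submodule ℂ (L →ₗ[ℂ] L) where
  carrier := {d | ∀ a b : L, d (A.br a b) = A.br (d a) b + A.br a (d b)}
  add_mem' := by
    intro d d' hd hd' a b
    simp only [LinearMap.add_apply, map_add, hd a b, hd' a b]
    abel
  zero_mem' := by intro a b; simp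
  smul_mem' := by
    intro c d hd a b
    simp only [LinearMap.smul_apply, map_smul, hd a b, smul_add]

/-- The left-hand side of the 2-cocycle equation, for a bilinear map `φ : L × L → L`. -/
def d2 (A : LeibnizStr L) (φ : L →ₗ[ℂ] L →ₗ[ℂ] L) (a b c : L) : L :=
  A.br a (φ b c) - A.br (φ a b) c + A.br (φ a c) b
    + φ a (A.br b c) - φ (A.br a b) c + φ (A.br a c) b

/-- The space `ZL²(L, L)` of 2-cocycles of `L` with coefficients in itself. -/
def ZL2 (A : LeibnizStr L) : Submodule ℂ (L →ₗ[ℂ] L →ₗ[ℂ] L) where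
  carrier := {φ | ∀ a b c : L, A.d2 φ a b c = 0}
  add_mem' := by
    intro φ ψ hφ hψ a b c
    have h : A.d2 (φ + ψ) a b c = A.d2 φ a b c + A.d2 ψ a b c := by
      simp only [d2, LinearMap.add_apply, map_add]
      abel
    rw [h, hφ a b c, hψ a b c, add_zero]
  zero_mem' := by intro a b c; simp [d2]
  smul_mem' := by
    intro r φ hφ a b c
    have h : A.d2 (r • φ) a b c = r • A.d2 φ a b c := by
      simp only [d2, LinearMap.smul_apply, map_smul, smul_add, smul_sub]
    rw [h, hφ a b c, smul_zero]

/-- The space `BL²(L, L)` of 2-coboundaries of `L` with coefficients in itself. -/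
def BL2 (A : LeibnizStr L) : Submodule ℂ (L →ₗ[ℂ] L →ₗ[ℂ] L) where
  carrier := {f | ∃ d : L →ₗ[ℂ] L, ∀ a b : L,
    f a b = A.br (d a) b + A.br a (d b) - d (A.br a b)}
  add_mem' := by
    rintro f g ⟨d, hd⟩ ⟨d', hd'⟩
    refine ⟨d + d', fun a b => ?_⟩
    simp only [LinearMap.add_apply, map_add, hd a b, hd' a b]
    abel
  zero_mem' := ⟨0, fun a b => by simp⟩
  smul_mem' := by
    rintro c f ⟨d, hd⟩
    refine ⟨c • d, fun a b => ?_⟩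
    simp only [LinearMap.smul_apply, map_smul, hd a b, smul_add, smul_sub]

/-- Every 2-coboundary is a 2-cocycle, so the quotient below is the usual one. -/
theorem BL2_le_ZL2 (A : LeibnizStr L) : A.BL2 ≤ A.ZL2 := by
  rintro f ⟨d, hd⟩ a b c
  have h1 := A.leibniz (d a) b c
  have h2 := A.leibniz a (d b) c
  have h3 := A.leibniz a b (d c)
  have h4 := congrArg d (A.leibniz a b c)
  simp only [map_sub] at h4
  simp only [d2, hd, map_add, map_sub, LinearMap.add_apply, LinearMap.sub_apply, h1, h2, h3, h4]
  abel

/-- Mathlib's additive group structure on bilinear maps, recorded as a shortcut because instance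
search does not find it in time for the quotient below. -/
instance bilinAddCommGroup : AddCommGroup (L →ₗ[ℂ] L →ₗ[ℂ] L) := LinearMap.addCommGroup

/-- The second Leibniz cohomology `HL²(L, L) = ZL²(L, L) / BL²(L, L)`. -/
abbrev HL2 (A : LeibnizStr L) : Type _ := A.ZL2 ⧸ A.BL2.submoduleOf A.ZL2

end

end LeibnizStr

/-- The underlying space of the direct sum of `t` copies of `l₂` and `s` copies of `r₂`. -/
abbrev SumSpace (t s : ℕ) : Type := (Fin t → ℂ × ℂ) × (Fin s → ℂ × ℂ)

/-- The direct sum of `t` copies of `l₂` and `s` copies of `r₂`. -/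
def sumAlg (t s : ℕ) : LeibnizStr (SumSpace t s) :=
  (LeibnizStr.copies t LeibnizStr.l2).prod (LeibnizStr.copies s LeibnizStr.r2)

/-- The algebra `L_t = l₂ ⊕ ⋯ ⊕ l₂ ⊕ r₂ ⊕ ⋯ ⊕ r₂` with `k` summands, `t ≤ k` of them `l₂`. -/
abbrev calL (k t : ℕ) : LeibnizStr (SumSpace t (k - t)) := sumAlg t (k - t)

/-- The basis vector `e_i`, in the `i`-th summand `l₂`. -/
def vecE {t : ℕ} (s : ℕ) (i : Fin t) : SumSpace t s := (Pi.single i (1, 0), 0)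

/-- The basis vector `x_i`, in the `i`-th summand `l₂`. -/
def vecX {t : ℕ} (s : ℕ) (i : Fin t) : SumSpace t s := (Pi.single i (0, 1), 0)

/-- The basis vector `f_j`, in the `j`-th summand `r₂`. -/
def vecF (t : ℕ) {s : ℕ} (j : Fin s) : SumSpace t s := (0, Pi.single j (1, 0))

/-- The basis vector `y_j`, in the `j`-th summand `r₂`. -/
def vecY (t : ℕ) {s : ℕ} (j : Fin s) : SumSpace t s := (0, Pi.single j (0, 1))

/-- The explicit form of a 2-cocycle: the values of `φ` on all pairs of basis vectors are given in
terms of free parameters. In the families indexed by `i ≠ j` or `i < j` only the corresponding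
parameters occur. -/
def HasCocycleForm {t s : ℕ} (φ : SumSpace t s →ₗ[ℂ] SumSpace t s →ₗ[ℂ] SumSpace t s) : Prop :=
  let e : Fin t → SumSpace t s := vecE s
  let x : Fin t → SumSpace t s := vecX s
  let f : Fin s → SumSpace t s := vecF t
  let y : Fin s → SumSpace t s := vecY t
  ∃ (α β₁ β₂ ν : Fin t → Fin t → ℂ) (β₃ β₄ τ : Fin t → Fin s → ℂ)
    (γ₁ γ₂ ξ₁ ξ₂ θ : Fin s → Fin t → ℂ) (ξ₃ ξ₄ δ₁ δ₂ η : Fin s → Fin s → ℂ),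
    (∀ i j, φ (x i) (x j) = α i j • e j) ∧
    (∀ i, φ (e i) (x i) = ∑ m, β₁ i m • x m + ∑ m, β₂ i m • e m
        + ∑ m, β₃ i m • y m + ∑ m, β₄ i m • f m) ∧
    (∀ i j, i ≠ j → φ (e j) (x i) = -β₂ j i • e i + ν j i • e j) ∧
    (∀ i j, φ (x i) (e j) = 0) ∧
    (∀ i j, φ (e i) (e j) = -β₁ j i • e i) ∧
    (∀ i j, φ (y j) (x i) = γ₁ j i • e i + γ₂ j i • f j) ∧
    (∀ i j, φ (x i) (y j) = -γ₂ j i • f j) ∧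
    (∀ i j, φ (f j) (x i) = -ξ₂ j i • e i + θ j i • f j) ∧
    (∀ i j, φ (x i) (f j) = -θ j i • f j) ∧
    (∀ i j, φ (e i) (y j) = -β₄ i j • f j + τ i j • e i) ∧
    (∀ i j, φ (y j) (e i) = β₄ i j • f j) ∧
    (∀ i j, φ (e i) (f j) = -ξ₁ j i • e i + β₃ i j • f j) ∧
    (∀ i j, φ (f j) (e i) = -β₃ i j • f j) ∧
    (∀ i, φ (y i) (y i) = 0) ∧
    (∀ i j, i < j → φ (y j) (y i) = δ₁ j i • f i + δ₂ j i • f j) ∧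
    (∀ i j, i < j → φ (y i) (y j) = -φ (y j) (y i)) ∧
    (∀ i, φ (f i) (y i) = ∑ m, ξ₁ i m • x m + ∑ m, ξ₂ i m • e m
        + ∑ m, ξ₃ i m • y m + ∑ m, ξ₄ i m • f m) ∧
    (∀ i j, i ≠ j → φ (f j) (y i) = -ξ₄ j i • f i + η j i • f j) ∧
    (∀ i j, φ (y i) (f j) = -φ (f j) (y i)) ∧
    (∀ i, φ (f i) (f i) = 0) ∧
    (∀ i j, j < i → φ (f i) (f j) = -ξ₃ j i • f i + ξ₃ i j • f j) ∧
    (∀ i j, j < i → φ (f j) (f i) = -φ (f i) (f j))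

/-! Write every summand with basis `e`, `x` and products `[e,x] = e`, `[x,e] = -ε e`, where `ε` is 0
for `l₂` and 1 for `r₂`; both types are then treated at once.

Coboundaries form the range, and derivations the kernel, of one linear map on endomorphisms.
`mem_der_iff` computes the kernel, and rank-nullity gives the dimension of the range.

Given a cocycle, `primitive` is an endomorphism whose coboundary agrees with it on a few chosen
coordinates. The difference is a cocycle vanishing there, hence zero by `eq_zero_of_normalized`. So
every cocycle is a coboundary.

The explicit form never has to be tested against the cocycle identity: coboundaries have it by their
values on basis vectors, and a map having it is the coboundary of its `primitive`. -/

namespace SumSpace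

/-! ### Uniform coordinates on the direct sum -/

variable {t s : ℕ}

/-- The basis vector `e` or `f` of a summand. -/
def vE : Fin t ⊕ Fin s → SumSpace t s := Sum.elim (vecE s) (vecF t)

/-- The basis vector `x` or `y` of a summand. -/
def vX : Fin t ⊕ Fin s → SumSpace t s := Sum.elim (vecX s) (vecY t)

/-- The coordinate at `vE i`. -/
def cE : Fin t ⊕ Fin s → SumSpace t s →ₗ[ℂ] ℂ :=
  Sum.elim
    (fun i => LinearMap.fst ℂ ℂ ℂ ∘ₗ LinearMap.proj i ∘ₗ LinearMap.fst ℂ _ _)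
    (fun i => LinearMap.fst ℂ ℂ ℂ ∘ₗ LinearMap.proj i ∘ₗ LinearMap.snd ℂ _ _)

/-- The coordinate at `vX i`. -/
def cX : Fin t ⊕ Fin s → SumSpace t s →ₗ[ℂ] ℂ :=
  Sum.elim
    (fun i => LinearMap.snd ℂ ℂ ℂ ∘ₗ LinearMap.proj i ∘ₗ LinearMap.fst ℂ _ _)
    (fun i => LinearMap.snd ℂ ℂ ℂ ∘ₗ LinearMap.proj i ∘ₗ LinearMap.snd ℂ _ _)

/-- `0` on the summands `l₂` and `1` on the summands `r₂`: there `[x, e] = -ε e`. -/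
def eps : Fin t ⊕ Fin s → ℂ := Sum.elim (fun _ => 0) (fun _ => 1)

@[simp] theorem eps_inl (i : Fin t) : eps (Sum.inl i : Fin t ⊕ Fin s) = 0 := rfl
@[simp] theorem eps_inr (i : Fin s) : eps (Sum.inr i : Fin t ⊕ Fin s) = 1 := rfl

theorem eps_eq (i : Fin t ⊕ Fin s) : eps i = 0 ∨ eps i = 1 := by
  rcases i with i | i <;> simp

theorem vE_inl (i : Fin t) : vE (Sum.inl i : Fin t ⊕ Fin s) = vecE s i := rfl
theorem vE_inr (i : Fin s) : vE (Sum.inr i : Fin t ⊕ Fin s) = vecF t i := rfl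
theorem vX_inl (i : Fin t) : vX (Sum.inl i : Fin t ⊕ Fin s) = vecX s i := rfl
theorem vX_inr (i : Fin s) : vX (Sum.inr i : Fin t ⊕ Fin s) = vecY t i := rfl

theorem ext_coord {u v : SumSpace t s} (hE : ∀ i, cE i u = cE i v) (hX : ∀ i, cX i u = cX i v) :
    u = v := by
  refine Prod.ext (funext fun i => Prod.ext ?_ ?_) (funext fun i => Prod.ext ?_ ?_)
  · exact hE (Sum.inl i)
  · exact hX (Sum.inl i)
  · exact hE (Sum.inr i)
  · exact hX (Sum.inr i)

@[simp] theorem cE_vE (i j : Fin t ⊕ Fin s) : cE i (vE j) = if i = j then 1 else 0 := by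
  rcases i with i | i <;> rcases j with j | j <;>
    simp [cE, vE, vecE, vecF, Pi.single_apply, apply_ite Prod.fst]

@[simp] theorem cE_vX (i j : Fin t ⊕ Fin s) : cE i (vX j) = 0 := by
  rcases i with i | i <;> rcases j with j | j <;>
    simp [cE, vX, vecX, vecY, Pi.single_apply, apply_ite Prod.fst]

@[simp] theorem cX_vX (i j : Fin t ⊕ Fin s) : cX i (vX j) = if i = j then 1 else 0 := by
  rcases i with i | i <;> rcases j with j | j <;>
    simp [cX, vX, vecX, vecY, Pi.single_apply, apply_ite Prod.snd]

@[simp] theorem cX_vE (i j : Fin t ⊕ Fin s) : cX i (vE j) = 0 := by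
  rcases i with i | i <;> rcases j with j | j <;>
    simp [cX, vE, vecE, vecF, Pi.single_apply, apply_ite Prod.snd]

theorem eq_sum (u : SumSpace t s) : u = ∑ i, cE i u • vE i + ∑ i, cX i u • vX i := by
  apply ext_coord <;> intro i <;> simp [map_sum, -Fintype.sum_sum_type]

@[simp] theorem cE_br (i : Fin t ⊕ Fin s) (u v : SumSpace t s) :
    cE i ((sumAlg t s).br u v) = cE i u * cX i v - eps i * cX i u * cE i v := by
  rcases i with i | i <;>
    simp [cE, cX, sumAlg, LeibnizStr.prod, LeibnizStr.copies, LeibnizStr.l2, LeibnizStr.r2]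

@[simp] theorem cX_br (i : Fin t ⊕ Fin s) (u v : SumSpace t s) :
    cX i ((sumAlg t s).br u v) = 0 := by
  rcases i with i | i <;>
    simp [cX, sumAlg, LeibnizStr.prod, LeibnizStr.copies, LeibnizStr.l2, LeibnizStr.r2]

theorem br_vE_right (u : SumSpace t s) (i : Fin t ⊕ Fin s) :
    (sumAlg t s).br u (vE i) = -(eps i * cX i u) • vE i := by
  apply ext_coord <;> intro j <;> by_cases h : j = i <;> simp [h]

theorem br_vX_right (u : SumSpace t s) (i : Fin t ⊕ Fin s) :
    (sumAlg t s).br u (vX i) = cE i u • vE i := by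
  apply ext_coord <;> intro j <;> by_cases h : j = i <;> simp [h]

theorem br_vE_left (i : Fin t ⊕ Fin s) (u : SumSpace t s) :
    (sumAlg t s).br (vE i) u = cX i u • vE i := by
  apply ext_coord <;> intro j <;> by_cases h : j = i <;> simp [h]

theorem br_vX_left (i : Fin t ⊕ Fin s) (u : SumSpace t s) :
    (sumAlg t s).br (vX i) u = -(eps i * cE i u) • vE i := by
  apply ext_coord <;> intro j <;> by_cases h : j = i <;> simp [h]

theorem linearMap_ext {M : Type*} [AddCommGroup M] [Module ℂ M]
    {D D' : SumSpace t s →ₗ[ℂ] M} (hE : ∀ i, D (vE i) = D' (vE i))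
    (hX : ∀ i, D (vX i) = D' (vX i)) : D = D' := by
  refine LinearMap.ext fun u => ?_
  rw [eq_sum u]
  simp only [map_add, map_sum, map_smul, hE, hX]

/-- The linear map with prescribed values on the basis vectors. -/
def ofBasis (p q : Fin t ⊕ Fin s → SumSpace t s) : SumSpace t s →ₗ[ℂ] SumSpace t s :=
  ∑ i, (cE i).smulRight (p i) + ∑ i, (cX i).smulRight (q i)

@[simp] theorem ofBasis_vE (p q : Fin t ⊕ Fin s → SumSpace t s) (i : Fin t ⊕ Fin s) :
    ofBasis p q (vE i) = p i := by
  simp [ofBasis, LinearMap.sum_apply, -Fintype.sum_sum_type]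

@[simp] theorem ofBasis_vX (p q : Fin t ⊕ Fin s → SumSpace t s) (i : Fin t ⊕ Fin s) :
    ofBasis p q (vX i) = q i := by
  simp [ofBasis, LinearMap.sum_apply, -Fintype.sum_sum_type]

end SumSpace

/-! ### The coboundary as a linear map -/

namespace LeibnizStr

variable {L : Type*} [AddCommGroup L] [Module ℂ L]

/-- The coboundary `(a, b) ↦ [d a, b] + [a, d b] - d [a, b]` of a linear map `d`. -/
def coboundary (A : LeibnizStr L) : (L →ₗ[ℂ] L) →ₗ[ℂ] L →ₗ[ℂ] L →ₗ[ℂ] L where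
  toFun d := A.br ∘ₗ d + A.br.compl₂ d - A.br.compr₂ d
  map_add' d d' := by
    ext a b
    simp only [LinearMap.add_apply, LinearMap.sub_apply, LinearMap.comp_apply,
      LinearMap.compl₂_apply, LinearMap.compr₂_apply, map_add]
    abel
  map_smul' c d := by
    ext a b
    simp only [LinearMap.add_apply, LinearMap.sub_apply, LinearMap.comp_apply,
      LinearMap.compl₂_apply, LinearMap.compr₂_apply, LinearMap.smul_apply, map_smul,
      RingHom.id_apply, smul_add, smul_sub]

theorem coboundary_apply (A : LeibnizStr L) (d : L →ₗ[ℂ] L) (a b : L) :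
    A.coboundary d a b = A.br (d a) b + A.br a (d b) - d (A.br a b) := rfl

theorem range_coboundary (A : LeibnizStr L) : LinearMap.range A.coboundary = A.BL2 := by
  ext f
  constructor
  · rintro ⟨d, rfl⟩
    exact ⟨d, A.coboundary_apply d⟩
  · rintro ⟨d, hd⟩
    exact ⟨d, by ext1 a; ext1 b; rw [hd, coboundary_apply]⟩

theorem ker_coboundary (A : LeibnizStr L) : LinearMap.ker A.coboundary = A.der := by
  ext d
  rw [LinearMap.mem_ker]
  constructor
  · intro h a b
    have := LinearMap.congr_fun (LinearMap.congr_fun h a) b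
    rw [coboundary_apply] at this
    exact (sub_eq_zero.mp this).symm
  · intro h
    ext1 a; ext1 b
    rw [coboundary_apply, h a b]
    exact sub_self _

theorem finrank_BL2_add_finrank_der [FiniteDimensional ℂ L] (A : LeibnizStr L) :
    Module.finrank ℂ A.BL2 + Module.finrank ℂ A.der = Module.finrank ℂ L ^ 2 := by
  rw [← range_coboundary, ← ker_coboundary, LinearMap.finrank_range_add_finrank_ker,
    Module.finrank_linearMap, sq]

end LeibnizStr

/-! ### Coboundaries on basis vectors -/

namespace SumSpace

variable {t s : ℕ}

theorem bilin_ext {φ ψ : SumSpace t s →ₗ[ℂ] SumSpace t s →ₗ[ℂ] SumSpace t s}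
    (hEE : ∀ i j, φ (vE i) (vE j) = ψ (vE i) (vE j))
    (hEX : ∀ i j, φ (vE i) (vX j) = ψ (vE i) (vX j))
    (hXE : ∀ i j, φ (vX i) (vE j) = ψ (vX i) (vE j))
    (hXX : ∀ i j, φ (vX i) (vX j) = ψ (vX i) (vX j)) : φ = ψ :=
  linearMap_ext (fun i => linearMap_ext (hEE i) (hEX i))
    (fun i => linearMap_ext (hXE i) (hXX i))

variable (D : SumSpace t s →ₗ[ℂ] SumSpace t s)

theorem coboundary_vE_vE (i j : Fin t ⊕ Fin s) :
    (sumAlg t s).coboundary D (vE i) (vE j) =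
      -(eps j * cX j (D (vE i))) • vE j + cX i (D (vE j)) • vE i := by
  rw [LeibnizStr.coboundary_apply, br_vE_right, br_vE_left, br_vE_left]
  simp

theorem coboundary_vE_vX (i j : Fin t ⊕ Fin s) :
    (sumAlg t s).coboundary D (vE i) (vX j) =
      cE j (D (vE i)) • vE j + cX i (D (vX j)) • vE i - if i = j then D (vE i) else 0 := by
  rw [LeibnizStr.coboundary_apply, br_vX_right, br_vE_left, br_vE_left]
  by_cases h : i = j <;> simp [h]

theorem coboundary_vX_vE (i j : Fin t ⊕ Fin s) :
    (sumAlg t s).coboundary D (vX i) (vE j) =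
      -(eps j * cX j (D (vX i))) • vE j - (eps i * cE i (D (vE j))) • vE i +
        if i = j then eps i • D (vE i) else 0 := by
  rw [LeibnizStr.coboundary_apply, br_vE_right, br_vX_left, br_vX_left]
  by_cases h : i = j <;> simp [h, sub_eq_add_neg]

theorem coboundary_vX_vX (i j : Fin t ⊕ Fin s) :
    (sumAlg t s).coboundary D (vX i) (vX j) =
      cE j (D (vX i)) • vE j - (eps i * cE i (D (vX j))) • vE i := by
  rw [LeibnizStr.coboundary_apply, br_vX_right, br_vX_left, br_vX_left]
  simp [sub_eq_add_neg]

end SumSpace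

/-! ### Derivations -/

namespace SumSpace

variable {t s : ℕ}

/-- The factor `eps i` covers both types: it forces `D x = 0` on `l₂` and leaves the multiples of
`f` free for `D y` on `r₂`. Vanishing of the coboundary on the pairs `(e, x)` and `(x, x)` already
forces these conditions. -/
theorem mem_der_iff (D : SumSpace t s →ₗ[ℂ] SumSpace t s) :
    D ∈ (sumAlg t s).der ↔
      (∀ i, D (vE i) = cE i (D (vE i)) • vE i) ∧
      (∀ i, D (vX i) = (eps i * cE i (D (vX i))) • vE i) := by
  rw [← LeibnizStr.ker_coboundary, LinearMap.mem_ker]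
  constructor
  · intro h
    have hEX (i j) := coboundary_vE_vX D i j
    have hXX (i j) := coboundary_vX_vX D i j
    simp only [h, LinearMap.zero_apply] at hEX hXX
    have h0 (i) : cX i (D (vX i)) = 0 := by
      simpa using (congrArg (cE i) (hEX i i)).symm
    refine ⟨fun i => ?_, fun i => ext_coord (fun j => ?_) fun j => ?_⟩
    · have := hEX i i
      rw [h0] at this
      exact (sub_eq_zero.mp (by simpa using this.symm)).symm
    · have := congrArg (cE j) (hXX i j)
      by_cases hij : j = i
      · subst hij
        simpa [sub_eq_zero] using this.symm
      · simpa [hij] using this.symm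
    · by_cases hij : j = i
      · subst hij
        simpa using h0 j
      · simpa [hij] using (congrArg (cE j) (hEX j i)).symm
  · rintro ⟨hE, hX⟩
    have hEE (i j) : cE i (D (vE j)) = if i = j then cE i (D (vE i)) else 0 := by
      rw [hE j]; by_cases h : i = j <;> simp [h]
    have hEX (i j) : cX i (D (vE j)) = 0 := by rw [hE j]; simp
    have hXX (i j) : cX i (D (vX j)) = 0 := by rw [hX j]; simp
    have hXE (i j) : cE i (D (vX j)) = if i = j then eps i * cE i (D (vX i)) else 0 := by
      rw [hX j]; by_cases h : i = j <;> simp [h]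
    have hX' (i) : cE i (D (vX i)) = eps i * cE i (D (vX i)) := by simpa using hXE i i
    refine bilin_ext (fun i j => ?_) (fun i j => ?_) (fun i j => ?_) fun i j => ?_
    · simp [coboundary_vE_vE, hEX]
    · rw [coboundary_vE_vX, hXX, hEE]
      by_cases h : i = j
      · subst h; simp [← hE i]
      · simp [h, Ne.symm h]
    · rw [coboundary_vX_vE, hXX, hEE]
      by_cases h : i = j
      · subst h; simp [mul_smul, ← hE i]
      · simp [h]
    · rw [coboundary_vX_vX, hXE j i, hXE i j]
      by_cases h : i = j
      · subst h
        simp [← hX' i]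
      · simp [h, Ne.symm h]

/-- A derivation is determined by its eigenvalues on the `vE i` and its values on the `y`. -/
def derCoord : (sumAlg t s).der →ₗ[ℂ] (Fin t ⊕ Fin s → ℂ) × (Fin s → ℂ) where
  toFun D := (fun i => cE i (D.1 (vE i)), fun j => cE (Sum.inr j) (D.1 (vX (Sum.inr j))))
  map_add' D D' := by ext <;> simp
  map_smul' c D := by ext <;> simp

theorem derCoord_bijective : Function.Bijective (derCoord (t := t) (s := s)) := by
  constructor
  · rw [injective_iff_map_eq_zero]
    rintro ⟨D, hD⟩ h
    obtain ⟨hE, hX⟩ := (mem_der_iff D).mp hD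
    have h1 (i) : cE i (D (vE i)) = 0 := congrFun (congrArg Prod.fst h) i
    have h2 (j) : cE (Sum.inr j) (D (vX (Sum.inr j))) = 0 := congrFun (congrArg Prod.snd h) j
    refine Subtype.ext (linearMap_ext (fun i => ?_) fun i => ?_)
    · simpa [h1] using hE i
    · change D (vX i) = 0
      rw [hX i]
      rcases i with i | i <;> simp [h2]
  · rintro ⟨p, q⟩
    refine ⟨⟨ofBasis (fun i => p i • vE i) (fun i => Sum.elim (fun _ => (0 : ℂ)) q i • vE i),
      (mem_der_iff _).mpr ⟨fun i => by simp, fun i => ?_⟩⟩, ?_⟩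
    · rcases i with i | i <;> simp
    · ext <;> simp [derCoord]

theorem finrank_der : Module.finrank ℂ (sumAlg t s).der = t + s + s := by
  rw [(LinearEquiv.ofBijective derCoord derCoord_bijective).finrank_eq]
  simp

theorem finrank_sumSpace : Module.finrank ℂ (SumSpace t s) = 2 * (t + s) := by
  simp [Module.finrank_pi_fintype]; ring

/-! ### Normalized cocycles vanish -/

section Cocycle

variable {ψ : SumSpace t s →ₗ[ℂ] SumSpace t s →ₗ[ℂ] SumSpace t s}

/-- Suitable basis triples in the cocycle identity kill the values on `(e,x)`, `(x,x)`, `(x,e)`,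
`(e,e)` in this order, each using earlier ones. -/
theorem eq_zero_of_normalized (hψ : ψ ∈ (sumAlg t s).ZL2)
    (h1 : ∀ i, ψ (vE i) (vX i) = 0) (h2 : ∀ i j, cE i (ψ (vE i) (vX j)) = 0)
    (h3 : ∀ i j, cE j (ψ (vX i) (vX j)) = 0) : ψ = 0 := by
  have T (a b c) : (sumAlg t s).d2 ψ a b c = 0 := hψ a b c
  simp only [LeibnizStr.d2] at T
  have hEX (i j) : ψ (vE i) (vX j) = 0 := by
    by_cases hij : i = j
    · rw [← hij, h1]
    -- This triple makes the value a multiple of `vE i`, a coordinate that `h2` kills.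
    have := T (vE i) (vX i) (vX j)
    simp only [br_vE_left, br_vX_right, h1, h2] at this
    have key : ψ (vE i) (vX j) = cX i (ψ (vX i) (vX j)) • vE i := by
      exact (sub_eq_zero.mp (by simpa [hij, Ne.symm hij] using this)).symm
    have h0 := congrArg (cE i) key
    rw [h2] at h0
    rw [key]
    simp at h0
    simp [← h0]
  have hXX (i j) : ψ (vX i) (vX j) = 0 := by
    refine ext_coord (fun m => ?_) fun m => ?_
    · by_cases hjm : j = m
      · subst hjm; simpa using h3 i j
      have := congrArg (cE m) (T (vX i) (vX j) (vX m))
      by_cases him : m = i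
      · subst him
        simpa [br_vX_right, Ne.symm hjm, h3] using this
      · simpa [br_vX_right, Ne.symm hjm, him, h3] using this
    · have := congrArg (cE m) (T (vE m) (vX i) (vX j))
      have h0 (i j n : Fin t ⊕ Fin s) : ψ ((sumAlg t s).br (vE i) (vX j)) (vX n) = 0 := by
        rw [br_vX_right]; by_cases h : j = i <;> simp [h, hEX]
      have h0' (i j : Fin t ⊕ Fin s) : (sumAlg t s).br (vX i) (vX j) = 0 := by
        rw [br_vX_right]; simp
      simpa [hEX, h0, h0'] using this
  have hXE' (i j) : ψ (vX i) (vE j) = cE j (ψ (vX i) (vE j)) • vE j := by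
    have := T (vX i) (vE j) (vX j)
    refine (neg_add_eq_zero.mp ?_).symm
    by_cases hij : i = j
    · subst hij
      simpa [br_vX_right, br_vE_right, h1, hXX] using this
    · simpa [br_vX_right, br_vE_right, h1, hXX, hij, Ne.symm hij] using this
  have hXE (i j) : ψ (vX i) (vE j) = 0 := by
    rw [hXE']
    have key : cE j (ψ (vX i) (vE j)) = 0 := by
      -- With `c` the coefficient in question, `h4` reads `(1 - 2ε) c = 0` if `i = j` and `(1 - ε) c
      -- = 0` otherwise; `h5` supplies `ε c = 0` for the missing case.
      have h4 := congrArg (cE j) (T (vX i) (vX j) (vE j))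
      have h5 := congrArg (cE j) (T (vX j) (vX i) (vE j))
      by_cases hij : i = j
      · subst hij
        rcases eps_eq i with h | h <;>
          simpa [br_vE_left, br_vX_right, br_vE_right, hXX, h1, h] using h4
      · rcases eps_eq j with h | h
        · simpa [br_vE_left, br_vX_right, br_vE_right, hXX, hEX, h, hij, Ne.symm hij] using h4
        · simpa [br_vE_left, br_vX_right, br_vE_right, hXX, hEX, h, hij, Ne.symm hij] using h5
    rw [key, zero_smul]
  have hEE (i j) : ψ (vE i) (vE j) = 0 := by
    have h4 := T (vE i) (vX i) (vE j)
    have h5 := T (vE i) (vE j) (vX j)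
    by_cases hij : i = j
    · subst hij
      have key : ψ (vE i) (vE i) + ψ (vE i) (vE i) = cE i (ψ (vE i) (vE i)) • vE i := by
        have h6 : -(cE i (ψ (vE i) (vE i)) • vE i) + ψ (vE i) (vE i) + ψ (vE i) (vE i) = 0 := by
          simpa [br_vX_right, br_vE_right, h1] using h5
        rwa [add_assoc, neg_add_eq_zero, eq_comm] at h6
      have h0 := congrArg (cE i) key
      simp at h0
      rw [h0, zero_smul, ← two_smul ℂ] at key
      simpa using key
    -- The value is a multiple of both `vE j` and `vE i`, hence zero.
    · have h6 : ψ (vE i) (vE j) = cE j (ψ (vE i) (vE j)) • vE j := by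
        refine (neg_add_eq_zero.mp ?_).symm
        simpa [br_vX_right, br_vE_right, hEX, hij, Ne.symm hij] using h5
      have h7 : ψ (vE i) (vE j) = cE i (ψ (vE i) (vE j)) • vE i := by
        refine (sub_eq_zero.mp ?_).symm
        simpa [br_vX_right, br_vE_right, hEX, hXE, hij, Ne.symm hij] using h4
      have h8 := congrArg (cE j) h7
      rw [h6]
      simp [Ne.symm hij] at h8
      simp [h8]
  exact bilin_ext hEE hEX hXE hXX

end Cocycle
end SumSpace

/-! ### Every cocycle is a coboundary -/

namespace SumSpace

variable {t s : ℕ} (φ : SumSpace t s →ₗ[ℂ] SumSpace t s →ₗ[ℂ] SumSpace t s)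

/-- A linear map whose coboundary is `φ` whenever `φ` is a cocycle. -/
def primitive : SumSpace t s →ₗ[ℂ] SumSpace t s :=
  -- These values solve the normalization equations; the `vE i`-coordinate of the image of `vE i` is
  -- free and is taken to be 0.
  ofBasis (fun i => cE i (φ (vE i) (vX i)) • vE i - φ (vE i) (vX i))
    (fun i => ∑ j, cE j (φ (vX i) (vX j)) • vE j + ∑ j, cE j (φ (vE j) (vX i)) • vX j)

theorem primitive_vE (i : Fin t ⊕ Fin s) :
    primitive φ (vE i) = cE i (φ (vE i) (vX i)) • vE i - φ (vE i) (vX i) := by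
  simp [primitive]

theorem cE_primitive_vX (i j : Fin t ⊕ Fin s) :
    cE j (primitive φ (vX i)) = cE j (φ (vX i) (vX j)) := by
  simp [primitive, -Fintype.sum_sum_type]

theorem cX_primitive_vX (i j : Fin t ⊕ Fin s) :
    cX j (primitive φ (vX i)) = cE j (φ (vE j) (vX i)) := by
  simp [primitive, -Fintype.sum_sum_type]

variable {φ}

theorem eq_coboundary_of_mem_ZL2 (hφ : φ ∈ (sumAlg t s).ZL2)
    (hx : ∀ i, eps i * cE i (φ (vX i) (vX i)) = 0) :
    φ = (sumAlg t s).coboundary (primitive φ) := by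
  refine sub_eq_zero.mp (eq_zero_of_normalized (Submodule.sub_mem _ hφ ?_)
    (fun i => ?_) (fun i j => ?_) fun i j => ?_)
  · exact LeibnizStr.BL2_le_ZL2 _ (LeibnizStr.range_coboundary (sumAlg t s) ▸
      LinearMap.mem_range_self _ _)
  · simp [coboundary_vE_vX, primitive_vE, cX_primitive_vX]
  · rw [LinearMap.sub_apply, LinearMap.sub_apply, coboundary_vE_vX, cX_primitive_vX]
    by_cases h : i = j
    · subst h; simp [primitive_vE]
    · simp [h]
  · rw [LinearMap.sub_apply, LinearMap.sub_apply, coboundary_vX_vX, cE_primitive_vX,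
      cE_primitive_vX]
    by_cases h : i = j
    · subst h; simp [hx]
    · simp [Ne.symm h]

/-- On `(y,y)` in a copy of `r₂` a coboundary has no `f`-coordinate in that copy, so no choice of
primitive can normalize it; the cocycle identity at `(y,y,y)` does. -/
theorem eps_mul_of_mem_ZL2 (hφ : φ ∈ (sumAlg t s).ZL2) (i : Fin t ⊕ Fin s) :
    eps i * cE i (φ (vX i) (vX i)) = 0 := by
  have := congrArg (cE i) (hφ (vX i) (vX i) (vX i))
  simpa [LeibnizStr.d2, br_vX_right] using this

theorem BL2_eq_ZL2 : (sumAlg t s).BL2 = (sumAlg t s).ZL2 := by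
  refine le_antisymm (LeibnizStr.BL2_le_ZL2 _) fun φ hφ => ?_
  rw [← LeibnizStr.range_coboundary]
  exact ⟨_, (eq_coboundary_of_mem_ZL2 hφ (eps_mul_of_mem_ZL2 hφ)).symm⟩

/-! ### The explicit form of cocycles -/

theorem hasCocycleForm_coboundary (D : SumSpace t s →ₗ[ℂ] SumSpace t s) :
    HasCocycleForm ((sumAlg t s).coboundary D) := by
  have hsum (u : SumSpace t s) : u = ∑ m, cX (Sum.inl m) u • vecX s m
      + ∑ m, cE (Sum.inl m) u • vecE s m + ∑ m, cX (Sum.inr m) u • vecY t m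
      + ∑ m, cE (Sum.inr m) u • vecF t m := by
    conv_lhs => rw [eq_sum u]
    simp only [Fintype.sum_sum_type, vE_inl, vE_inr, vX_inl, vX_inr]
    abel
  have hEE := coboundary_vE_vE D
  have hEX := coboundary_vE_vX D
  have hXE := coboundary_vX_vE D
  have hXX := coboundary_vX_vX D
  generalize hφ : (sumAlg t s).coboundary D = φ at *
  unfold HasCocycleForm
  intro e x f y
  -- The `β` and `ξ` are coordinates of `φ(e,x)` and `φ(f,y)`; the others are, up to sign,
  -- coordinates of `D` on the `x` and `y`.
  refine ⟨fun i j => cE (.inl j) (D (x i)), fun i j => cX (.inl j) (φ (e i) (x i)),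
    fun i j => cE (.inl j) (φ (e i) (x i)), fun i j => cX (.inl i) (D (x j)),
    fun i j => cX (.inr j) (φ (e i) (x i)), fun i j => cE (.inr j) (φ (e i) (x i)),
    fun i j => cX (.inl i) (D (y j)),
    fun i j => cE (.inl j) (D (y i)), fun i j => -cE (.inr i) (D (x j)),
    fun i j => cX (.inl j) (φ (f i) (y i)), fun i j => cE (.inl j) (φ (f i) (y i)),
    fun i j => cX (.inr i) (D (x j)),
    fun i j => cX (.inr j) (φ (f i) (y i)), fun i j => cE (.inr j) (φ (f i) (y i)),
    fun i j => cE (.inr j) (D (y i)), fun i j => -cE (.inr i) (D (y j)),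
    fun i j => cX (.inr i) (D (y j)), ?_⟩
  simp only [e, x, f, y, ← vE_inl, ← vE_inr, ← vX_inl, ← vX_inr] at hsum ⊢
  refine ⟨?_, fun i => hsum _, ?_, ?_, ?_, ?_, ?_, ?_, ?_, ?_, ?_, ?_, ?_, ?_, ?_, ?_,
    fun i => hsum _, ?_, ?_, ?_, ?_, ?_⟩
  -- `hsum` rewrites any vector, so `simp [*]` must not see it.
  all_goals clear hsum
  all_goals intro i
  all_goals try intro j
  all_goals try intro hij
  all_goals try by_cases h : j = i
  all_goals try subst h
  all_goals try have h2 := Ne.symm h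
  all_goals try exact (lt_irrefl _ hij).elim
  all_goals try exact (hij rfl).elim
  all_goals simp [*]
  all_goals module

theorem eq_coboundary_of_hasCocycleForm (hφ : HasCocycleForm φ) :
    φ = (sumAlg t s).coboundary (primitive φ) := by
  obtain ⟨α, β₁, β₂, ν, β₃, β₄, τ, γ₁, γ₂, ξ₁, ξ₂, θ, ξ₃, ξ₄, δ₁, δ₂, η,
    hxx, hex, hex', hxe, hee, hyx, hxy, hfx, hxf, hey, hye, hef, hfe, hyy, hyy1, hyy2,
    hfy, hfy', hyf, hff, hff1, hff2⟩ := hφ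
  simp only [← vE_inl, ← vE_inr, ← vX_inl, ← vX_inr] at *
  have a1 (i m) : cX (.inl m) (φ (vE (.inl i)) (vX (.inl i))) = β₁ i m := by
    rw [hex]; simp [Finset.sum_ite_eq]
  have a2 (i m) : cE (.inl m) (φ (vE (.inl i)) (vX (.inl i))) = β₂ i m := by
    rw [hex]; simp [Finset.sum_ite_eq]
  have a3 (i m) : cX (.inr m) (φ (vE (.inl i)) (vX (.inl i))) = β₃ i m := by
    rw [hex]; simp [Finset.sum_ite_eq]
  have a4 (i m) : cE (.inr m) (φ (vE (.inl i)) (vX (.inl i))) = β₄ i m := by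
    rw [hex]; simp [Finset.sum_ite_eq]
  have b1 (i m) : cX (.inl m) (φ (vE (.inr i)) (vX (.inr i))) = ξ₁ i m := by
    rw [hfy]; simp [Finset.sum_ite_eq]
  have b2 (i m) : cE (.inl m) (φ (vE (.inr i)) (vX (.inr i))) = ξ₂ i m := by
    rw [hfy]; simp [Finset.sum_ite_eq]
  have b3 (i m) : cX (.inr m) (φ (vE (.inr i)) (vX (.inr i))) = ξ₃ i m := by
    rw [hfy]; simp [Finset.sum_ite_eq]
  have b4 (i m) : cE (.inr m) (φ (vE (.inr i)) (vX (.inr i))) = ξ₄ i m := by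
    rw [hfy]; simp [Finset.sum_ite_eq]
  -- Only the coordinates `a1`–`b4` are needed; the full expansions would make `simp [*]` unfold
  -- `φ(e,x)` and `φ(f,y)` into sums.
  clear hex hfy
  refine bilin_ext (fun i j => ?_) (fun i j => ?_) (fun i j => ?_) fun i j => ?_
  · rw [coboundary_vE_vE, primitive_vE, primitive_vE]
    rcases i with i | i <;> rcases j with j | j
    · simp [*]
    · simp [*]; module
    · simp [*]
    · rcases lt_trichotomy i j with h | rfl | h
      · simp [*]; module
      · simp [*]
      · simp [*]; module
  · rw [coboundary_vE_vX, primitive_vE, cX_primitive_vX]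
    by_cases h : i = j
    · subst h; simp
    · rcases i with i | i <;> rcases j with j | j <;> simp at h
      · simp [*, Ne.symm h]
      · simp [*]
      · simp [*]
      · simp [*, Ne.symm h]
  · rw [coboundary_vX_vE, primitive_vE, primitive_vE, cX_primitive_vX]
    by_cases h : i = j
    · subst h
      rcases i with i | i
      · simp [*]
      · simp [*]; module
    · rcases i with i | i <;> rcases j with j | j <;> simp at h
      · simp [*, Ne.symm h]
      · simp [*]
      · simp [*]
      · simp [*, Ne.symm h]
  · rw [coboundary_vX_vX, cE_primitive_vX, cE_primitive_vX]
    rcases i with i | i <;> rcases j with j | j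
    · simp [*]
    · simp [*]
    · simp [*]
    · rcases lt_trichotomy i j with h | rfl | h
      · simp [*, h.ne, h.ne']; abel
      · simp [*]
      · simp [*, h.ne, h.ne']

theorem mem_ZL2_iff_hasCocycleForm : φ ∈ (sumAlg t s).ZL2 ↔ HasCocycleForm φ := by
  rw [← BL2_eq_ZL2, ← LeibnizStr.range_coboundary]
  constructor
  · rintro ⟨D, rfl⟩
    exact hasCocycleForm_coboundary D
  · exact fun h => ⟨_, (eq_coboundary_of_hasCocycleForm h).symm⟩

/-! ### Vanishing of cohomology and dimensions -/

instance subsingleton_HL2 : Subsingleton (sumAlg t s).HL2 := by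
  refine Submodule.Quotient.subsingleton_iff.mpr ?_
  rw [Submodule.submoduleOf, Submodule.comap_subtype_eq_top]
  exact BL2_eq_ZL2.ge

theorem finrank_BL2 : (Module.finrank ℂ (sumAlg t s).BL2 : ℤ) = 4 * (t + s) ^ 2 - (t + 2 * s) := by
  have h := (sumAlg t s).finrank_BL2_add_finrank_der
  rw [finrank_der, finrank_sumSpace] at h
  zify at h
  linarith

end SumSpace

theorem mainTheorem4 (k t : ℕ) (ht : t ≤ k) :
    (Module.finrank ℂ (calL k t).der : ℤ) = 2 * k - t ∧
    (Module.finrank ℂ (calL k t).BL2 : ℤ) = 4 * k ^ 2 - 2 * k + t ∧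
    (∀ φ : SumSpace t (k - t) →ₗ[ℂ] SumSpace t (k - t) →ₗ[ℂ] SumSpace t (k - t),
      φ ∈ (calL k t).ZL2 ↔ HasCocycleForm φ) ∧
    (Module.finrank ℂ (calL k t).ZL2 : ℤ) = 4 * k ^ 2 - 2 * k + t ∧
    Module.finrank ℂ (calL k t).HL2 = 0 ∧
    Subsingleton (calL k t).HL2 := by
  obtain ⟨s, rfl⟩ := Nat.exists_eq_add_of_le ht
  have hB : (Module.finrank ℂ (calL (t + s) t).BL2 : ℤ) =
      4 * ((t + s : ℕ) : ℤ) ^ 2 - 2 * ((t + s : ℕ) : ℤ) + t := by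
    rw [SumSpace.finrank_BL2, Nat.add_sub_cancel_left]
    push_cast
    ring
  refine ⟨?_, hB, fun φ => SumSpace.mem_ZL2_iff_hasCocycleForm, ?_,
    Module.finrank_zero_of_subsingleton, SumSpace.subsingleton_HL2⟩
  · rw [SumSpace.finrank_der, Nat.add_sub_cancel_left]
    push_cast
    ring
  · rw [calL, ← SumSpace.BL2_eq_ZL2]
    exact hB
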